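/- Let $G$ be a finite simple graph with maximum degree $\Delta$ that is of Class 2, i.e. its chromatic index is not equal to $\Delta$. Let $a,b,u,x,y$ be five distinct vertices of $G$ such that $ab$, $bu$, $ux$, $uy$ are edges of $G$, and let $\varphi$ be a $\Delta$-edge-coloring of $G-ab$, i.e. a map from the edges of $G-ab$ to $\{1,\dots,\Delta\}$ that gives different colors to any two adjacent edges. For a vertex $v$ let $\overline{\varphi}(v)$ be the set of colors in $\{1,\dots,\Delta\}$ that are not assigned to any edge of $G-ab$ incident with $v$. A Kierstead path with respect to an edge $e_1$ of $G$ and an edge-coloring $\varphi$ of $G-e_1$ is a sequence $(y_0,e_1,y_1,\dots,e_p,y_p)$ with $p\ge 1$, where $y_0,\dots,y_p$ are distinct vertices, $e_i=y_{i-1}y_i$ is an edge of $G$ for $1\le i\le p$, and for every $2\le i\le p$ there is a $j$ with $0\le j<i$ and $\varphi(e_i)\in\overline{\varphi}(y_j)$. If $(a,ab,b,bu,u,ux,x)$ and $(a,ab,b,bu,u,uy,y)$ are both Kierstead paths with respect to $ab$ and $\varphi$, then $$|\overline{\varphi}(x)\cap(\overline{\varphi}(a)\cup\overline{\varphi}(b))|+|\overline{\varphi}(y)\cap(\overline{\varphi}(a)\cup\overline{\varphi}(b))|\le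 1.$$ -/

import Mathlib

namespace SimpleGraph

variable {V : Type*}

/-- A `k`-edge-coloring of `G`: a map from the edges of `G` to `k` colors such that any two
distinct edges with a common end receive different colors. -/
abbrev EdgeColoring (G : SimpleGraph V) (k : ℕ) : Type _ :=
  G.lineGraph.Coloring (Fin k)

/-- The chromatic index of `G`: the least `k` such that `G` has a `k`-edge-coloring. -/
noncomputable def chromaticIndex (G : SimpleGraph V) : ℕ∞ :=
  G.lineGraph.chromaticNumber

/-- A finite graph is of Class 1 if its chromatic index equals its maximum degree, and of
Class 2 otherwise. -/
def IsClassTwo [Fintype V] (G : SimpleGraph V) [DecidableRel G.Adj] : Prop :=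
  G.chromaticIndex ≠ (G.maxDegree : ℕ∞)

namespace EdgeColoring

open Classical in
/-- The set of colors present at the vertex `v`. -/
noncomputable def present {G : SimpleGraph V} {k : ℕ} (φ : G.EdgeColoring k) (v : V) :
    Finset (Fin k) :=
  Finset.univ.filter fun c => ∃ e : G.edgeSet, v ∈ (e : Sym2 V) ∧ φ e = c

/-- The set of colors missing at the vertex `v`. -/
noncomputable def missing {G : SimpleGraph V} {k : ℕ} (φ : G.EdgeColoring k) (v : V) :
    Finset (Fin k) :=
  Finset.univ \ φ.present v

end EdgeColoring

/-- Let `φ` be a `k`-edge-coloring of `G - e`. The vertices `y 0, …, y (p + 1)` are those of a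
Kierstead path `(y 0, e₁, y 1, …, e_{p+1}, y (p + 1))` with respect to `e` and `φ`, where the
`i`-th edge, counted from `0`, joins `y i` and `y (i + 1)`. The length `p + 1` is at least `1`. -/
structure IsKiersteadPath (G : SimpleGraph V) {k : ℕ} (e : Sym2 V)
    (φ : (G.deleteEdges {e}).EdgeColoring k) {p : ℕ} (y : Fin (p + 2) → V) : Prop where
  /-- The vertices are distinct. -/
  injective : Function.Injective y
  /-- Consecutive vertices are joined by an edge of `G`. -/
  adj : ∀ i : Fin (p + 1), G.Adj (y i.castSucc) (y i.succ)
  /-- The first edge is `e`. -/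
  first : s(y 0, y 1) = e
  /-- The color of each edge other than the first is missing at one of the vertices that precede
  the end of this edge. -/
  color : ∀ i : Fin (p + 1), i ≠ 0 →
    ∃ h : s(y i.castSucc, y i.succ) ∈ (G.deleteEdges {e}).edgeSet,
      ∃ j : Fin (p + 2), j < i.succ ∧ φ ⟨s(y i.castSucc, y i.succ), h⟩ ∈ φ.missing (y j)

end SimpleGraph

/-!
Since `G` has no edge coloring with the colors at hand, no color is missing at both `a` and `b`, and
for `α` missing at `a` and `β` missing at `b` the `(α, β)`-chain that starts at `a` ends at `b`.
Interchanging `α` and `β` on the chain through another vertex therefore does not affect the colors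
missing at `a` and `b` or the color `o` of `bu`. If two colors are counted by the sum, such changes
lead to one of three situations: `o` is missing at both `x` and `y`, or `o` is missing at one of
them and a color missing at `b` is missing at the other, or `o` is missing at the end of a path
`a, b, u, z` whose last edge has a color that is missing at `b`. In the last one the edges of the
path can be recolored directly. In the other two, delete the four edges of the fork, which makes
more colors missing at its vertices; at most three Kempe changes in the rest of the graph then make
these colors fit together so that the whole fork can be colored again.
-/

open SimpleGraph

namespace Kempe

variable {V C : Type*}

section Components

theorem card_filter_degree_le_one_le_two [Fintype V] {K : SimpleGraph V} [DecidableRel K.Adj]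
    (hK : K.Connected) (hdeg : ∀ v, K.degree v ≤ 2) :
    (Finset.univ.filter fun v => K.degree v ≤ 1).card ≤ 2 := by
  have hcard := hK.card_vert_le_card_edgeSet_add_one
  rw [Nat.card_eq_fintype_card, Nat.card_eq_fintype_card, ← edgeFinset_card] at hcard
  have hsum : ∑ v, (K.degree v + if K.degree v ≤ 1 then 1 else 0) ≤ ∑ _v : V, 2 :=
    Finset.sum_le_sum fun v _ => by grind
  rw [Finset.sum_add_distrib, K.sum_degrees_eq_twice_card_edges, ← Finset.card_filter,
    Finset.sum_const, Finset.card_univ, smul_eq_mul] at hsum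
  omega

theorem eq_or_eq_of_reachable {K : SimpleGraph V} (hK : ∀ v, (K.neighborSet v).encard ≤ 2)
    {p q r : V} (hpq : p ≠ q) (hp : (K.neighborSet p).encard ≤ 1)
    (hq : (K.neighborSet q).encard ≤ 1) (hr : (K.neighborSet r).encard ≤ 1)
    (hpq' : K.Reachable p q) (hpr : K.Reachable p r) : r = p ∨ r = q := by
  classical
  obtain ⟨P⟩ := hpq'
  obtain ⟨Q⟩ := hpr
  set S : Set V := {v | v ∈ P.support} ∪ {v | v ∈ Q.support}
  have hS : (K.induce S).Connected :=
    induce_union_connected P.connected_induce_support.preconnected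
      Q.connected_induce_support.preconnected ⟨p, P.start_mem_support, Q.start_mem_support⟩
  have : Fintype S := ((P.support.finite_toSet).union Q.support.finite_toSet).fintype
  have hdeg (v : S) : ((K.induce S).degree v : ℕ∞) ≤ (K.neighborSet v).encard := by
    rw [← card_neighborSet_eq_degree, ← ENat.card_eq_coe_fintype_card]
    exact Function.Embedding.encard_le ((Embedding.induce S).mapNeighborSet v)
  by_contra! hne
  let ends : Finset S := {⟨p, .inl P.start_mem_support⟩, ⟨q, .inl P.end_mem_support⟩,
    ⟨r, .inr Q.end_mem_support⟩}
  have hends : ends.card = 3 := Finset.card_eq_three.2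
    ⟨_, _, _, Subtype.coe_ne_coe.1 hpq, Subtype.coe_ne_coe.1 hne.1.symm,
      Subtype.coe_ne_coe.1 hne.2.symm, rfl⟩
  have hle : ends ⊆ Finset.univ.filter fun v => (K.induce S).degree v ≤ 1 := by
    intro v hv
    have : (K.neighborSet v).encard ≤ 1 := by
      simp only [ends, Finset.mem_insert, Finset.mem_singleton] at hv
      rcases hv with rfl | rfl | rfl <;> assumption
    simpa using mod_cast (hdeg v).trans this
  have := (Finset.card_le_card hle).trans
    (card_filter_degree_le_one_le_two hS fun v => mod_cast (hdeg v).trans (hK v))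
  omega

end Components

section Coloring

variable {H H' : SimpleGraph V} {c : Sym2 V → C} {v w p q : V} {γ δ : C}

/-- Adjacent edges of `H` get different colors from `c`. Edge colorings of all subgraphs of a graph
on `V` are maps on `Sym2 V`, whose values at pairs that are not edges play no role. -/
def IsProperOn (H : SimpleGraph V) (c : Sym2 V → C) : Prop :=
  ∀ ⦃v w w' : V⦄, H.Adj v w → H.Adj v w' → c s(v, w) = c s(v, w') → w = w'

/-- The colors that are missing at the vertex `v` of `H`. -/
def missing (H : SimpleGraph V) (c : Sym2 V → C) (v : V) : Set C :=
  {γ | ∀ w, H.Adj v w → c s(v, w) ≠ γ}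

/-- The edges of `G` can be properly colored with colors from `C`. -/
def EdgeColorable (G : SimpleGraph V) (C : Type*) : Prop :=
  ∃ c : Sym2 V → C, IsProperOn G c

theorem missing_anti (h : H' ≤ H) : missing H c v ⊆ missing H' c v :=
  fun _ hγ w hw => hγ w (h hw)

theorem IsProperOn.mono (hc : IsProperOn H c) (h : H' ≤ H) : IsProperOn H' c :=
  fun _ _ _ hw hw' => hc (h hw) (h hw')

theorem IsProperOn.mem_missing_of_le_deleteEdges (hc : IsProperOn H c) (hvw : H.Adj v w)
    (hH' : H' ≤ H.deleteEdges {s(v, w)}) :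
    c s(v, w) ∈ missing H' c v ∧ c s(v, w) ∈ missing H' c w := by
  constructor <;> intro z hz h <;> obtain ⟨hz', hne⟩ := deleteEdges_adj.1 (hH' hz)
  · exact hne (congrArg _ (hc hz' hvw h))
  · rw [Sym2.eq_swap (a := v)] at h hne
    exact hne (congrArg _ (hc hz' hvw.symm h))

theorem IsProperOn.update [DecidableEq V] (hc : IsProperOn (H.deleteEdges {s(p, q)}) c)
    (hp : γ ∈ missing (H.deleteEdges {s(p, q)}) c p)
    (hq : γ ∈ missing (H.deleteEdges {s(p, q)}) c q) :
    IsProperOn H (Function.update c s(p, q) γ) := by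
  have hγ {v w : V} (h : s(v, w) = s(p, q)) : γ ∈ missing (H.deleteEdges {s(p, q)}) c v := by
    rcases Sym2.mem_iff.1 (h ▸ Sym2.mem_mk_left v w) with rfl | rfl <;> assumption
  intro v w w' hw hw' h
  simp only [Function.update_apply] at h
  split_ifs at h with h₁ h₂ h₂
  · exact Sym2.congr_right.1 (h₁.trans h₂.symm)
  · exact absurd h.symm (hγ h₁ w' (by simp [hw', h₂]))
  · exact absurd h (hγ h₂ w (by simp [hw, h₁]))
  · exact hc (by simp [hw, h₁]) (by simp [hw', h₂]) h

theorem mem_missing_update [DecidableEq V] (hδ : δ ∈ missing (H.deleteEdges {s(p, q)}) c v)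
    (h : δ = γ → v ≠ p ∧ v ≠ q) : δ ∈ missing H (Function.update c s(p, q) γ) v := by
  intro w hvw
  rcases eq_or_ne s(v, w) s(p, q) with he | he
  · rw [he, Function.update_self]
    grind
  · rw [Function.update_of_ne he]
    exact hδ w (by simp [hvw, he])

end Coloring

section Kempe

variable {H : SimpleGraph V} {c : Sym2 V → C} {v w p q r s : V} {α β γ δ : C} {S T : Set V}

/-- The graph formed by the edges of `H` of color `α` or `β`; its components are the Kempe chains
for these two colors. -/
def kempeGraph (H : SimpleGraph V) (c : Sym2 V → C) (α β : C) : SimpleGraph V where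
  Adj v w := H.Adj v w ∧ (c s(v, w) = α ∨ c s(v, w) = β)
  symm := ⟨fun v w h => by rw [Sym2.eq_swap]; exact ⟨h.1.symm, h.2⟩⟩
  loopless := ⟨fun _ h => h.1.ne rfl⟩

/-- The set `S` is a union of Kempe chains: no edge of color `α` or `β` leaves it. -/
def IsKempeClosed (H : SimpleGraph V) (c : Sym2 V → C) (α β : C) (S : Set V) : Prop :=
  ∀ ⦃v w : V⦄, (kempeGraph H c α β).Adj v w → (v ∈ S ↔ w ∈ S)

/-- The vertex set of the Kempe chain with the colors `α` and `β` through `p`. -/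
def kempeChain (H : SimpleGraph V) (c : Sym2 V → C) (α β : C) (p : V) : Set V :=
  {v | (kempeGraph H c α β).Reachable p v}

/-- The vertex `v` is an end of its Kempe chain: one of the two colors is missing at `v`. -/
def IsKempeEnd (H : SimpleGraph V) (c : Sym2 V → C) (α β : C) (v : V) : Prop :=
  α ∈ missing H c v ∨ β ∈ missing H c v

theorem IsKempeClosed.compl (hS : IsKempeClosed H c α β S) : IsKempeClosed H c α β Sᶜ :=
  fun _ _ h => not_congr (hS h)

theorem IsKempeClosed.union (hS : IsKempeClosed H c α β S) (hT : IsKempeClosed H c α β T) :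
    IsKempeClosed H c α β (S ∪ T) :=
  fun _ _ h => or_congr (hS h) (hT h)

theorem mem_kempeChain_self (H : SimpleGraph V) (c : Sym2 V → C) (α β : C) (p : V) :
    p ∈ kempeChain H c α β p :=
  Reachable.refl p

theorem mem_kempeChain_comm : q ∈ kempeChain H c α β p ↔ p ∈ kempeChain H c α β q :=
  reachable_comm

theorem isKempeClosed_kempeChain (H : SimpleGraph V) (c : Sym2 V → C) (α β : C) (p : V) :
    IsKempeClosed H c α β (kempeChain H c α β p) :=
  fun _ _ h => ⟨fun hv => hv.trans h.reachable, fun hw => hw.trans h.symm.reachable⟩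

theorem IsProperOn.encard_neighborSet_kempeGraph_le (hc : IsProperOn H c) {s : Set C}
    (h : ∀ w, (kempeGraph H c α β).Adj v w → c s(v, w) ∈ s) :
    ((kempeGraph H c α β).neighborSet v).encard ≤ s.encard :=
  Set.encard_le_encard_of_injOn (f := fun w => c s(v, w)) h fun _ hw _ hw' => hc hw.1 hw'.1

theorem IsProperOn.encard_neighborSet_kempeGraph_le_one (hc : IsProperOn H c)
    (hv : IsKempeEnd H c α β v) : ((kempeGraph H c α β).neighborSet v).encard ≤ 1 := by
  rcases hv with hv | hv
  · rw [← Set.encard_singleton β]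
    exact hc.encard_neighborSet_kempeGraph_le fun w hw => hw.2.resolve_left (hv w hw.1)
  · rw [← Set.encard_singleton α]
    exact hc.encard_neighborSet_kempeGraph_le fun w hw => hw.2.resolve_right (hv w hw.1)

theorem IsProperOn.eq_or_eq_of_mem_kempeChain (hc : IsProperOn H c) (hpq : p ≠ q)
    (hp : IsKempeEnd H c α β p) (hq : IsKempeEnd H c α β q) (hr : IsKempeEnd H c α β r)
    (hpq' : q ∈ kempeChain H c α β p) (hpr : r ∈ kempeChain H c α β p) : r = p ∨ r = q :=
  eq_or_eq_of_reachable
    (fun _ => (hc.encard_neighborSet_kempeGraph_le fun _ hw => hw.2).trans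
      (Set.encard_insert_le {β} α |>.trans (by simp [one_add_one_eq_two])))
    hpq (hc.encard_neighborSet_kempeGraph_le_one hp) (hc.encard_neighborSet_kempeGraph_le_one hq)
    (hc.encard_neighborSet_kempeGraph_le_one hr) hpq' hpr

theorem IsProperOn.exists_isKempeClosed_of_isKempeEnd (hc : IsProperOn H c)
    (hp : IsKempeEnd H c α β p) :
    ∃ S, IsKempeClosed H c α β S ∧ p ∈ S ∧ ∀ ⦃q r⦄, [p, q, r].Nodup → IsKempeEnd H c α β q →
      IsKempeEnd H c α β r → q ∈ S → r ∉ S := by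
  refine ⟨_, isKempeClosed_kempeChain H c α β p, mem_kempeChain_self H c α β p, ?_⟩
  intro q r hd hq hr hqS hrS
  have := hc.eq_or_eq_of_mem_kempeChain (by grind) hp hq hr hqS hrS
  grind

theorem IsProperOn.exists_isKempeClosed_pairing (hc : IsProperOn H c) (hd : [p, q, r, s].Nodup)
    (hp : IsKempeEnd H c α β p) (hq : IsKempeEnd H c α β q) (hr : IsKempeEnd H c α β r)
    (hs : IsKempeEnd H c α β s) :
    ∃ S, IsKempeClosed H c α β S ∧ p ∈ S ∧
      (q ∈ S ∧ r ∉ S ∧ s ∉ S ∨ q ∉ S ∧ r ∈ S ∧ s ∉ S ∨ q ∉ S ∧ r ∉ S ∧ s ∈ S) := by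
  have closed := isKempeClosed_kempeChain H c α β
  have self := mem_kempeChain_self H c α β
  have comm {v w : V} := mem_kempeChain_comm (H := H) (c := c) (α := α) (β := β) (p := v) (q := w)
  have ends {v w z : V} :=
    hc.eq_or_eq_of_mem_kempeChain (α := α) (β := β) (p := v) (q := w) (r := z)
  by_cases hp' : q ∈ kempeChain H c α β p ∨ r ∈ kempeChain H c α β p ∨ s ∈ kempeChain H c α β p
  · exact ⟨_, closed p, self p, by grind⟩
  by_cases hq' : r ∈ kempeChain H c α β q ∨ s ∈ kempeChain H c α β q
  · exact ⟨_, (closed q).compl, by grind⟩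
  · exact ⟨_, (closed p).union (closed q), .inl (self p), by grind⟩

open scoped Classical in
/-- The permutation that interchanging `α` and `β` on the set `S` induces on the colors at `v`. -/
noncomputable def swapAt (α β : C) (S : Set V) (v : V) : Equiv.Perm C :=
  if v ∈ S then Equiv.swap α β else 1

open scoped Classical in
/-- The coloring obtained from `c` by a Kempe change: the colors `α` and `β` are interchanged on the
edges that meet `S`. -/
noncomputable def kempeSwap (c : Sym2 V → C) (α β : C) (S : Set V) (e : Sym2 V) : C :=
  if ∃ v ∈ e, v ∈ S then Equiv.swap α β (c e) else c e

open scoped Classical in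
theorem swapAt_apply : swapAt α β S v γ =
    if v ∈ S then if γ = α then β else if γ = β then α else γ else γ := by
  unfold swapAt
  split_ifs <;> simp_all [Equiv.swap_apply_def]

theorem IsKempeClosed.kempeSwap_apply (hS : IsKempeClosed H c α β S) (h : H.Adj v w) :
    kempeSwap c α β S s(v, w) = swapAt α β S v (c s(v, w)) := by
  have hvw : c s(v, w) = α ∨ c s(v, w) = β → (v ∈ S ↔ w ∈ S) := fun h' => hS ⟨h, h'⟩
  have hmeet : (∃ v' ∈ s(v, w), v' ∈ S) ↔ v ∈ S ∨ w ∈ S := by simp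
  simp only [kempeSwap, swapAt_apply, hmeet, Equiv.swap_apply_def]
  grind

theorem IsProperOn.kempeSwap (hc : IsProperOn H c) (hS : IsKempeClosed H c α β S) :
    IsProperOn H (kempeSwap c α β S) := by
  intro v w w' hw hw' h
  rw [hS.kempeSwap_apply hw, hS.kempeSwap_apply hw', (swapAt α β S v).apply_eq_iff_eq] at h
  exact hc hw hw' h

theorem IsKempeClosed.mem_missing_kempeSwap (hS : IsKempeClosed H c α β S) :
    γ ∈ missing H (Kempe.kempeSwap c α β S) v ↔ swapAt α β S v γ ∈ missing H c v := by
  refine forall₂_congr fun w hw => ?_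
  rw [hS.kempeSwap_apply hw]
  grind [swapAt_apply]

theorem IsKempeClosed.of_kempeSwap (hT : IsKempeClosed H c γ δ T) (hS : IsKempeClosed H c α β S)
    (hd : [α, β, γ, δ].Nodup) : IsKempeClosed H (kempeSwap c α β S) γ δ T := by
  rintro v w ⟨hw, h⟩
  refine hT ⟨hw, ?_⟩
  rw [hS.kempeSwap_apply hw, swapAt_apply] at h
  grind

end Kempe

section Fork

variable {G : SimpleGraph V} {c : Sym2 V → C} {a b u x y : V} {α β o p q r s σ τ : C} {S : Set V}
  {A B U X Y A' B' U' X' Y' : Set C}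

/-- The graph `G` without the edges `ab`, `bu` and `ux` of a path. -/
def deletePath (G : SimpleGraph V) (a b u x : V) : SimpleGraph V :=
  ((G.deleteEdges {s(a, b)}).deleteEdges {s(b, u)}).deleteEdges {s(u, x)}

/-- The graph `G` without the edges `ab`, `bu`, `ux` and `uy` of a fork. -/
def deleteFork (G : SimpleGraph V) (a b u x y : V) : SimpleGraph V :=
  (deletePath G a b u x).deleteEdges {s(u, y)}

theorem EdgeColorable.of_path (hd : [a, b, u, x].Nodup) (hc : IsProperOn (deletePath G a b u x) c)
    (hap : p ∈ missing (deletePath G a b u x) c a) (hbp : p ∈ missing (deletePath G a b u x) c b)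
    (hbq : q ∈ missing (deletePath G a b u x) c b) (huq : q ∈ missing (deletePath G a b u x) c u)
    (hur : r ∈ missing (deletePath G a b u x) c u) (hxr : r ∈ missing (deletePath G a b u x) c x)
    (hpq : p ≠ q) (hqr : q ≠ r) : EdgeColorable G C := by
  classical
  have h₁ := hc.update hur hxr
  have h₂ := h₁.update (mem_missing_update hbq (by grind)) (mem_missing_update huq (by grind))
  exact ⟨_, h₂.update (mem_missing_update (mem_missing_update hap (by grind)) (by grind))
    (mem_missing_update (mem_missing_update hbp (by grind)) (by grind))⟩

/-- A proper coloring `c` of `G` without the edges of the fork `ab`, `bu`, `ux`, `uy`, with colors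
`A`, `B`, `U`, `X`, `Y` that are missing at `a`, `b`, `u`, `x`, `y`. -/
structure IsForkColoring (G : SimpleGraph V) (a b u x y : V) (c : Sym2 V → C)
    (A B U X Y : Set C) : Prop where
  nodup : [a, b, u, x, y].Nodup
  isProperOn : IsProperOn (deleteFork G a b u x y) c
  subset_a : A ⊆ missing (deleteFork G a b u x y) c a
  subset_b : B ⊆ missing (deleteFork G a b u x y) c b
  subset_u : U ⊆ missing (deleteFork G a b u x y) c u
  subset_x : X ⊆ missing (deleteFork G a b u x y) c x
  subset_y : Y ⊆ missing (deleteFork G a b u x y) c y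

namespace IsForkColoring

theorem edgeColorable (h : IsForkColoring G a b u x y c {p} {p, q} {q, r, s} {r} {s})
    (hpq : p ≠ q) (hqr : q ≠ r) (hqs : q ≠ s) (hrs : r ≠ s) : EdgeColorable G C := by
  classical
  have hd := h.nodup
  refine .of_path (c := Function.update c s(u, y) s) (p := p) (q := q) (r := r)
    (a := a) (b := b) (u := u) (x := x) (by grind)
    (h.isProperOn.update (h.subset_u (by simp)) (h.subset_y (by simp)))
    (mem_missing_update (h.subset_a (by simp)) ?_) (mem_missing_update (h.subset_b (by simp)) ?_)
    (mem_missing_update (h.subset_b (by simp)) ?_) (mem_missing_update (h.subset_u (by simp)) ?_)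
    (mem_missing_update (h.subset_u (by simp)) ?_) (mem_missing_update (h.subset_x (by simp)) ?_)
    hpq hqr <;> grind

theorem swap (h : IsForkColoring G a b u x y c A B U X Y)
    (hS : IsKempeClosed (deleteFork G a b u x y) c α β S)
    (hA : ∀ γ ∈ A', swapAt α β S a γ ∈ A) (hB : ∀ γ ∈ B', swapAt α β S b γ ∈ B)
    (hU : ∀ γ ∈ U', swapAt α β S u γ ∈ U) (hX : ∀ γ ∈ X', swapAt α β S x γ ∈ X)
    (hY : ∀ γ ∈ Y', swapAt α β S y γ ∈ Y) :
    IsForkColoring G a b u x y (kempeSwap c α β S) A' B' U' X' Y' where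
  nodup := h.nodup
  isProperOn := h.isProperOn.kempeSwap hS
  subset_a _ hγ := hS.mem_missing_kempeSwap.2 (h.subset_a (hA _ hγ))
  subset_b _ hγ := hS.mem_missing_kempeSwap.2 (h.subset_b (hB _ hγ))
  subset_u _ hγ := hS.mem_missing_kempeSwap.2 (h.subset_u (hU _ hγ))
  subset_x _ hγ := hS.mem_missing_kempeSwap.2 (h.subset_x (hX _ hγ))
  subset_y _ hγ := hS.mem_missing_kempeSwap.2 (h.subset_y (hY _ hγ))

theorem edgeColorable_of_pair
    (h : IsForkColoring G a b u x y c {o} {o, τ} {o, σ, τ} {o, β} {o, β})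
    (hd : [o, β, σ, τ].Nodup) : EdgeColorable G C := by
  have hV := h.nodup
  obtain ⟨S, hS, hu, hends⟩ := h.isProperOn.exists_isKempeClosed_of_isKempeEnd (p := u) (α := σ)
    (β := β) (.inl (h.subset_u (by simp)))
  by_cases hx : x ∈ S
  · have hy : y ∉ S :=
      hends (by grind) (.inr (h.subset_x (by simp))) (.inr (h.subset_y (by simp))) hx
    have h' : IsForkColoring G a b u x y (kempeSwap c σ β Sᶜ) {o} {o, τ} {τ, o, σ} {o} {σ} := by
      apply h.swap hS.compl <;> grind [swapAt_apply]
    apply h'.edgeColorable <;> grind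
  · have h' : IsForkColoring G a b u x y (kempeSwap c σ β Sᶜ) {o} {o, τ} {τ, σ, o} {σ} {o} := by
      apply h.swap hS.compl <;> grind [swapAt_apply]
    apply h'.edgeColorable <;> grind

theorem edgeColorable_of_shared
    (h : IsForkColoring G a b u x y c {o, β, σ} {o, β} {o, σ, τ} {τ} {o, β})
    (hd : [o, β, σ, τ].Nodup) : EdgeColorable G C := by
  have hV := h.nodup
  obtain ⟨S, hS, hu, hends⟩ := h.isProperOn.exists_isKempeClosed_of_isKempeEnd (p := u) (α := σ)
    (β := β) (.inl (h.subset_u (by simp)))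
  by_cases hb : b ∈ S
  · have ha : a ∉ S :=
      hends (by grind) (.inr (h.subset_b (by simp))) (.inr (h.subset_a (by simp))) hb
    have hy : y ∉ S :=
      hends (by grind) (.inr (h.subset_b (by simp))) (.inr (h.subset_y (by simp))) hb
    have h' : IsForkColoring G a b u x y (kempeSwap c σ β Sᶜ) {β} {β, o} {o, τ, σ} {τ} {σ} := by
      apply h.swap hS.compl <;> grind [swapAt_apply]
    apply h'.edgeColorable <;> grind
  · have h' : IsForkColoring G a b u x y (kempeSwap c σ β S) {o} {o, β} {β, τ, o} {τ} {o} := by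
      apply h.swap hS <;> grind [swapAt_apply]
    apply h'.edgeColorable <;> grind

theorem edgeColorable_of_distinct
    (h : IsForkColoring G a b u x y c {o, σ, τ} {o, β} {o, σ, τ} {σ, β} {τ, o})
    (hd : [o, β, σ, τ].Nodup) : EdgeColorable G C := by
  have hV := h.nodup
  obtain ⟨S, hS, hu, hends⟩ := h.isProperOn.exists_isKempeClosed_of_isKempeEnd (p := u) (α := τ)
    (β := β) (.inl (h.subset_u (by simp)))
  by_cases hb : b ∈ S
  · have hends_b {v : V} (hv : [u, b, v].Nodup) (hv' : IsKempeEnd _ c τ β v) : v ∉ S :=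
      hends hv (.inr (h.subset_b (by simp))) hv' hb
    have ha : a ∉ S := hends_b (by grind) (.inl (h.subset_a (by simp)))
    have hx : x ∉ S := hends_b (by grind) (.inr (h.subset_x (by simp)))
    have hy : y ∉ S := hends_b (by grind) (.inl (h.subset_y (by simp)))
    have h' : IsForkColoring G a b u x y (kempeSwap c τ β Sᶜ) {o, β, σ} {o, β} {o, σ, τ}
        {τ} {o, β} := by
      apply h.swap hS.compl <;> grind [swapAt_apply]
    exact h'.edgeColorable_of_shared (by grind)
  · have h' : IsForkColoring G a b u x y (kempeSwap c τ β S) {o} {o, β} {β, σ, o} {σ} {o} := by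
      apply h.swap hS <;> grind [swapAt_apply]
    apply h'.edgeColorable <;> grind

theorem edgeColorable_of_crossed
    (h : IsForkColoring G a b u x y c {o, β, τ} {o, β} {o, σ, τ} {o, β} {o, τ})
    (hd : [o, β, σ, τ].Nodup) : EdgeColorable G C := by
  have hV := h.nodup
  obtain ⟨S, hS, haS, hS'⟩ := h.isProperOn.exists_isKempeClosed_pairing (α := σ) (β := o)
    (p := a) (q := b) (r := x) (s := y) (by grind) (.inr (h.subset_a (by simp)))
    (.inr (h.subset_b (by simp))) (.inr (h.subset_x (by simp))) (.inr (h.subset_y (by simp)))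
  obtain ⟨T, hT, hbT, hT'⟩ := h.isProperOn.exists_isKempeClosed_pairing (α := β) (β := τ)
    (p := b) (q := u) (r := x) (s := y) (by grind) (.inl (h.subset_b (by simp)))
    (.inr (h.subset_u (by simp))) (.inl (h.subset_x (by simp))) (.inr (h.subset_y (by simp)))
  have hTS : IsKempeClosed (deleteFork G a b u x y) (kempeSwap c σ o S) β τ T :=
    hT.of_kempeSwap hS (by grind)
  rcases hS' with hS' | hS' | hS'
  · have h' : IsForkColoring G a b u x y (kempeSwap c σ o S) {β} {β, σ} {σ, o, τ} {o} {τ} := by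
      apply h.swap hS <;> grind [swapAt_apply]
    apply h'.edgeColorable <;> grind
  · have h' : IsForkColoring G a b u x y (kempeSwap c σ o S) {β} {β, o} {o, σ, τ} {σ} {τ} := by
      apply h.swap hS <;> grind [swapAt_apply]
    apply h'.edgeColorable <;> grind
  have h' : IsForkColoring G a b u x y (kempeSwap c σ o S) {β, τ} {o, β} {o, σ, τ} {o, β}
      {σ, τ} := by
    apply h.swap hS <;> grind [swapAt_apply]
  rcases hT' with hT' | hT' | hT'
  · have h'' : IsForkColoring G a b u x y (kempeSwap (kempeSwap c σ o S) β τ T) {τ} {τ, o}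
        {o, β, σ} {β} {σ} := by
      apply h'.swap hTS <;> grind [swapAt_apply]
    apply h''.edgeColorable <;> grind
  · have h'' : IsForkColoring G a b u x y (kempeSwap (kempeSwap c σ o S) β τ T) {τ} {τ, o}
        {o, τ, σ} {τ} {σ} := by
      apply h'.swap hTS <;> grind [swapAt_apply]
    apply h''.edgeColorable <;> grind
  · have h'' : IsForkColoring G a b u x y (kempeSwap c β τ T) {o} {o, τ} {o, σ, τ} {o, β}
        {o, β} := by
      apply h.swap hT <;> grind [swapAt_apply]
    exact h''.edgeColorable_of_pair (by grind)

theorem edgeColorable_of_common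
    (h : IsForkColoring G a b u x y c {o, σ, τ} {o, β} {o, σ, τ} {σ, o} {τ, o})
    (hd : [o, β, σ, τ].Nodup) : EdgeColorable G C := by
  have hV := h.nodup
  obtain ⟨S, hS, hu, hends⟩ := h.isProperOn.exists_isKempeClosed_of_isKempeEnd (p := u) (α := σ)
    (β := β) (.inl (h.subset_u (by simp)))
  by_cases hb : b ∈ S
  · have ha : a ∉ S :=
      hends (by grind) (.inr (h.subset_b (by simp))) (.inl (h.subset_a (by simp))) hb
    have hx : x ∉ S :=
      hends (by grind) (.inr (h.subset_b (by simp))) (.inl (h.subset_x (by simp))) hb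
    have h' : IsForkColoring G a b u x y (kempeSwap c σ β Sᶜ) {o, β, τ} {o, β} {o, σ, τ} {o, β}
        {o, τ} := by
      apply h.swap hS.compl <;> grind [swapAt_apply]
    exact h'.edgeColorable_of_crossed (by grind)
  · have h' : IsForkColoring G a b u x y (kempeSwap c σ β S) {o} {o, β} {β, o, τ} {o} {τ} := by
      apply h.swap hS <;> grind [swapAt_apply]
    apply h'.edgeColorable <;> grind

end IsForkColoring
end Fork

section Stem

variable {G : SimpleGraph V} {c : Sym2 V → C} {a b u x y z : V} {α β γ o p q δ ε : C} {S : Set V}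
  {A B A' B' : Set C}

/-- A proper coloring `c` of `G - ab`, where `G` itself cannot be colored, that assigns to the edge
`bu` a color `o ∈ A`. Here `A` and `B` are sets of colors missing at `a` and `b`. -/
structure IsStem (G : SimpleGraph V) (a b u : V) (A B : Set C) (o : C) (c : Sym2 V → C) :
    Prop where
  not_edgeColorable : ¬ EdgeColorable G C
  ne_b : a ≠ b
  ne_u : a ≠ u
  adj : (G.deleteEdges {s(a, b)}).Adj b u
  isProperOn : IsProperOn (G.deleteEdges {s(a, b)}) c
  subset_a : A ⊆ missing (G.deleteEdges {s(a, b)}) c a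
  subset_b : B ⊆ missing (G.deleteEdges {s(a, b)}) c b
  color : c s(b, u) = o
  mem : o ∈ A

/-- An edge `uz` of color `p` that extends a stem to a path, together with a color `δ` that is
missing at `z`; both colors are missing at `a` or `b`. -/
structure IsLeg (G : SimpleGraph V) (a b u : V) (A B : Set C) (c : Sym2 V → C) (z : V) (p δ : C) :
    Prop where
  ne_a : a ≠ z
  ne_b : b ≠ z
  adj : (G.deleteEdges {s(a, b)}).Adj u z
  color : c s(u, z) = p
  color_mem : p ∈ A ∪ B
  missing : δ ∈ missing (G.deleteEdges {s(a, b)}) c z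
  missing_mem : δ ∈ A ∪ B

theorem IsLeg.color_ne_missing (hx : IsLeg G a b u A B c x p δ) : p ≠ δ := by
  rw [← hx.color, Sym2.eq_swap]
  exact hx.missing u hx.adj.symm

theorem IsLeg.kempeSwap (hx : IsLeg G a b u A B c x p δ)
    (hS : IsKempeClosed (G.deleteEdges {s(a, b)}) c α β S) (hα : α ∈ A) (hβ : β ∈ B) :
    IsLeg G a b u A B (kempeSwap c α β S) x (swapAt α β S u p) (swapAt α β S x δ) where
  ne_a := hx.ne_a
  ne_b := hx.ne_b
  adj := hx.adj
  color := by rw [hS.kempeSwap_apply hx.adj, hx.color]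
  color_mem := by grind [swapAt_apply, hx.color_mem]
  missing := by
    rw [hS.mem_missing_kempeSwap]
    convert hx.missing using 1
    grind [swapAt_apply]
  missing_mem := by grind [swapAt_apply, hx.missing_mem]

namespace IsStem

theorem notMem_right (h : IsStem G a b u A B o c) (hγ : γ ∈ A) : γ ∉ B := by
  classical
  exact fun hγ' => h.not_edgeColorable ⟨_, h.isProperOn.update (h.subset_a hγ) (h.subset_b hγ')⟩

theorem ne_color (h : IsStem G a b u A B o c) (hx : IsLeg G a b u A B c x p δ) : o ≠ p := by
  rw [← h.color, ← hx.color, Sym2.eq_swap]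
  exact fun he => hx.ne_b (h.isProperOn h.adj.symm hx.adj he)

theorem color_ne (h : IsStem G a b u A B o c) (hxy : x ≠ y) (hx : IsLeg G a b u A B c x p δ)
    (hy : IsLeg G a b u A B c y q ε) : p ≠ q := by
  rw [← hx.color, ← hy.color]
  exact fun he => hxy (h.isProperOn hx.adj hy.adj he)

theorem kempeSwap (h : IsStem G a b u A B o c)
    (hS : IsKempeClosed (G.deleteEdges {s(a, b)}) c α β S) (ha : a ∉ S) (hb : b ∉ S) :
    IsStem G a b u A B o (kempeSwap c α β S) where
  not_edgeColorable := h.not_edgeColorable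
  ne_b := h.ne_b
  ne_u := h.ne_u
  adj := h.adj
  isProperOn := h.isProperOn.kempeSwap hS
  subset_a γ hγ := by rw [hS.mem_missing_kempeSwap, swapAt_apply, if_neg ha]; exact h.subset_a hγ
  subset_b γ hγ := by rw [hS.mem_missing_kempeSwap, swapAt_apply, if_neg hb]; exact h.subset_b hγ
  color := by rw [hS.kempeSwap_apply h.adj, h.color, swapAt_apply, if_neg hb]
  mem := h.mem

theorem mem_kempeChain (h : IsStem G a b u A B o c) (hα : α ∈ A) (hβ : β ∈ B) :
    b ∈ kempeChain (G.deleteEdges {s(a, b)}) c α β a := by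
  classical
  by_contra hb
  have hS := isKempeClosed_kempeChain (G.deleteEdges {s(a, b)}) c α β a
  have ha := mem_kempeChain_self (G.deleteEdges {s(a, b)}) c α β a
  refine h.not_edgeColorable ⟨_, (h.isProperOn.kempeSwap hS).update (γ := β) ?_ ?_⟩ <;>
    rw [hS.mem_missing_kempeSwap]
  · simpa [swapAt, ha] using h.subset_a hα
  · simpa [swapAt, hb] using h.subset_b hβ

/-- The chain through `z` avoids `a` and `b`, as these are the two ends of another chain. -/
theorem exists_kempeSwap (h : IsStem G a b u A B o c) (hα : α ∈ A) (hβ : β ∈ B)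
    (hz : IsLeg G a b u A B c z p δ) (hδ : δ = α ∨ δ = β) :
    ∃ c' S, IsStem G a b u A B o c' ∧ z ∈ S ∧ (o = α → u ∉ S) ∧
      ∀ ⦃z' p' δ'⦄, IsLeg G a b u A B c z' p' δ' → (p' = α ∨ p' = β → (u ∈ S ↔ z' ∈ S)) ∧
        IsLeg G a b u A B c' z' (swapAt α β S u p') (swapAt α β S z' δ') := by
  set S := kempeChain (G.deleteEdges {s(a, b)}) c α β z with hSz
  have hS : IsKempeClosed (G.deleteEdges {s(a, b)}) c α β S := isKempeClosed_kempeChain _ c α β z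
  have hz' : z ∉ kempeChain (G.deleteEdges {s(a, b)}) c α β a := by
    intro hza
    have hend : IsKempeEnd (G.deleteEdges {s(a, b)}) c α β z := by
      rcases hδ with rfl | rfl
      exacts [.inl hz.missing, .inr hz.missing]
    rcases h.isProperOn.eq_or_eq_of_mem_kempeChain h.ne_b (.inl (h.subset_a hα))
      (.inr (h.subset_b hβ)) hend (h.mem_kempeChain hα hβ) hza with rfl | rfl
    exacts [hz.ne_a rfl, hz.ne_b rfl]
  have ha : a ∉ S := by rwa [hSz, mem_kempeChain_comm]
  have hb : b ∉ S := by
    rw [hSz, mem_kempeChain_comm]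
    exact fun hzb => hz' ((h.mem_kempeChain hα hβ).trans hzb)
  refine ⟨_, S, h.kempeSwap hS ha hb, mem_kempeChain_self _ c α β z, ?_, fun z' p' δ' hz' =>
    ⟨?_, hz'.kempeSwap hS hα hβ⟩⟩
  · exact fun ho => mt (hS ⟨h.adj, .inl (h.color.trans ho)⟩).2 hb
  · exact fun hp => hS ⟨hz'.adj, by rwa [hz'.color]⟩

theorem isForkColoring (h : IsStem G a b u A B o c) (hxy : x ≠ y)
    (hx : IsLeg G a b u A B c x p δ) (hy : IsLeg G a b u A B c y q ε) (hA : A' ⊆ A)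
    (hB : B' ⊆ insert o B) : IsForkColoring G a b u x y c A' B' {o, p, q} {p, δ} {q, ε} := by
  set H := G.deleteEdges {s(a, b)}
  have hle : deleteFork G a b u x y ≤ H :=
    (deleteEdges_le _).trans <| (deleteEdges_le _).trans <| deleteEdges_le _
  have hbu : deleteFork G a b u x y ≤ H.deleteEdges {s(b, u)} :=
    (deleteEdges_le _).trans <| deleteEdges_le _
  have hux : deleteFork G a b u x y ≤ H.deleteEdges {s(u, x)} :=
    (deleteEdges_le _).trans <| deleteEdges_mono (deleteEdges_le _)
  have huy : deleteFork G a b u x y ≤ H.deleteEdges {s(u, y)} :=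
    deleteEdges_mono <| (deleteEdges_le _).trans <| deleteEdges_le _
  obtain ⟨hbo, huo⟩ := h.color ▸ h.isProperOn.mem_missing_of_le_deleteEdges h.adj hbu
  obtain ⟨hup, hxp⟩ := hx.color ▸ h.isProperOn.mem_missing_of_le_deleteEdges hx.adj hux
  obtain ⟨huq, hyq⟩ := hy.color ▸ h.isProperOn.mem_missing_of_le_deleteEdges hy.adj huy
  refine ⟨?_, h.isProperOn.mono hle, (hA.trans h.subset_a).trans (missing_anti hle),
    hB.trans (Set.insert_subset hbo (h.subset_b.trans (missing_anti hle))), ?_, ?_, ?_⟩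
  · simp [h.ne_b, h.ne_u, hx.ne_a, hy.ne_a, h.adj.ne, hx.ne_b, hy.ne_b, hx.adj.ne, hy.adj.ne, hxy]
  · simp [Set.insert_subset_iff, huo, hup, huq]
  · simp [Set.insert_subset_iff, hxp, missing_anti hle hx.missing]
  · simp [Set.insert_subset_iff, hyq, missing_anti hle hy.missing]

theorem color_mem_left (h : IsStem G a b u A B o c) (hx : IsLeg G a b u A B c x p o) : p ∈ A := by
  refine hx.color_mem.resolve_right fun hp => h.not_edgeColorable ?_
  set H := G.deleteEdges {s(a, b)}
  have hle : deletePath G a b u x ≤ H := (deleteEdges_le _).trans <| deleteEdges_le _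
  obtain ⟨hbo, huo⟩ := h.color ▸ h.isProperOn.mem_missing_of_le_deleteEdges h.adj
    (H' := deletePath G a b u x) (deleteEdges_le _)
  obtain ⟨hup, -⟩ := hx.color ▸ h.isProperOn.mem_missing_of_le_deleteEdges hx.adj
    (H' := deletePath G a b u x) (deleteEdges_mono (deleteEdges_le _))
  refine .of_path (by simp [h.ne_b, h.ne_u, hx.ne_a, h.adj.ne, hx.ne_b, hx.adj.ne])
    (h.isProperOn.mono hle) (missing_anti hle (h.subset_a h.mem)) hbo
    (missing_anti hle (h.subset_b hp)) hup huo (missing_anti hle hx.missing)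
    (h.ne_color hx) (h.ne_color hx).symm

theorem false_of_missing_right (h : IsStem G a b u A B o c) (hx : IsLeg G a b u A B c x p β)
    (hy : IsLeg G a b u A B c y q o) (hp : p ∈ A) (hq : q ∈ A) (hβ : β ∈ B) : False := by
  have hr {γ : C} := h.notMem_right (γ := γ)
  have hop := h.ne_color hx
  have hoq := h.ne_color hy
  rcases eq_or_ne x y with rfl | hxy
  · obtain ⟨c', S, h', hxS, -, hS⟩ := h.exists_kempeSwap hp hβ hx (.inr rfl)
    obtain ⟨hu, hy'⟩ := hS hy
    obtain rfl : p = q := hx.color.symm.trans hy.color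
    have hy' : IsLeg G a b u A B c' x β o := by
      convert hy' using 1 <;> grind [swapAt_apply, h.mem]
    exact hr (h'.color_mem_left hy') hβ
  · refine h.not_edgeColorable ((h.isForkColoring hxy hx hy (A' := {o, p, q}) (B' := {o, β}) ?_
      ?_).edgeColorable_of_distinct ?_)
    · simp [Set.insert_subset_iff, h.mem, hp, hq]
    · simp [Set.insert_subset_iff, hβ]
    · grind [h.color_ne hxy hx hy, h.mem]

theorem false_of_missing_color (h : IsStem G a b u A B o c) (hxy : x ≠ y)
    (hx : IsLeg G a b u A B c x p o) (hy : IsLeg G a b u A B c y q o) (hβ : β ∈ B) : False := by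
  have hp := h.color_mem_left hx
  have hq := h.color_mem_left hy
  have hr {γ : C} := h.notMem_right (γ := γ)
  refine h.not_edgeColorable ((h.isForkColoring hxy hx hy (A' := {o, p, q}) (B' := {o, β}) ?_
    ?_).edgeColorable_of_common ?_)
  · simp [Set.insert_subset_iff, h.mem, hp, hq]
  · simp [Set.insert_subset_iff, hβ]
  · grind [h.color_ne hxy hx hy, h.mem, h.ne_color hx, h.ne_color hy]

theorem leg_unique_of_color (h : IsStem G a b u A B o c) (hB : B.Nonempty)
    (hx : IsLeg G a b u A B c x p δ) (hy : IsLeg G a b u A B c y q o) : x = y ∧ δ = o := by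
  have hr {γ : C} := h.notMem_right (γ := γ)
  have hop := h.ne_color hx
  have hpδ := hx.color_ne_missing
  by_contra hne
  have hq := h.color_mem_left hy
  rcases hx.color_mem with hp | hp <;> rcases hx.missing_mem with hδ | hδ
  · rcases eq_or_ne δ o with rfl | hδo
    · exact h.false_of_missing_color (by grind) hx hy hB.some_mem
    · obtain ⟨β, hβ⟩ := hB
      obtain ⟨c', S, h', hxS, -, hS⟩ := h.exists_kempeSwap hδ hβ hx (.inl rfl)
      have hx' : IsLeg G a b u A B c' x p β := by
        convert (hS hx).2 using 1 <;> grind [swapAt_apply]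
      have hy' : IsLeg G a b u A B c' y (swapAt δ β S u q) o := by
        convert (hS hy).2 using 1; grind [swapAt_apply, h.mem]
      exact h'.false_of_missing_right hx' hy' hp (h'.color_mem_left hy') hβ
  · exact h.false_of_missing_right hx hy hp hq hδ
  · obtain ⟨c', S, h', hxS, -, hS⟩ := h.exists_kempeSwap hδ hp hx (.inl rfl)
    have hx' : IsLeg G a b u A B c' x δ p := by
      convert (hS hx).2 using 1 <;> grind [swapAt_apply]
    have hoδ : o ≠ δ := by
      rintro rfl
      exact hr (h.color_mem_left hx) hp
    have hy' : IsLeg G a b u A B c' y (swapAt δ p S u q) o := by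
      convert (hS hy).2 using 1; grind [swapAt_apply]
    exact h'.false_of_missing_right hx' hy' hδ (h'.color_mem_left hy') hp
  · obtain ⟨c', S, h', hxS, hu, hS⟩ := h.exists_kempeSwap h.mem hδ hx (.inr rfl)
    have hx' : IsLeg G a b u A B c' x p o := by
      convert (hS hx).2 using 1 <;> grind [swapAt_apply]
    exact hr (h'.color_mem_left hx') hp

theorem leg_unique_of_missing_right (h : IsStem G a b u A B o c)
    (hx : IsLeg G a b u A B c x p δ) (hy : IsLeg G a b u A B c y q ε) (hε : ε ∈ B) :
    x = y ∧ δ = ε := by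
  obtain ⟨c', S, h', hyS, -, hS⟩ := h.exists_kempeSwap h.mem hε hy (.inr rfl)
  have hy' : IsLeg G a b u A B c' y (swapAt o ε S u q) o := by
    convert (hS hy).2 using 1; grind [swapAt_apply]
  obtain ⟨rfl, hδ⟩ := h'.leg_unique_of_color ⟨ε, hε⟩ (hS hx).2 hy'
  exact ⟨rfl, by grind [swapAt_apply]⟩

theorem leg_unique (h : IsStem G a b u A B o c) (hB : B.Nonempty)
    (hx : IsLeg G a b u A B c x p δ) (hy : IsLeg G a b u A B c y q ε) : x = y ∧ δ = ε := by
  rcases hy.missing_mem with hε | hε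
  · obtain ⟨β, hβ⟩ := hB
    obtain ⟨c', S, h', hyS, -, hS⟩ := h.exists_kempeSwap hε hβ hy (.inl rfl)
    have hy' : IsLeg G a b u A B c' y (swapAt ε β S u q) β := by
      convert (hS hy).2 using 1; grind [swapAt_apply]
    obtain ⟨rfl, hδ⟩ := h'.leg_unique_of_missing_right (hS hx).2 hy' hβ
    exact ⟨rfl, by grind [swapAt_apply]⟩
  · exact h.leg_unique_of_missing_right hx hy hε

end IsStem
end Stem

section EdgeColoring

variable {G H : SimpleGraph V} {a b u v x : V} {k : ℕ} {c : Sym2 V → Fin k} {γ : Fin k}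

theorem mem_present_iff (φ : H.EdgeColoring k) :
    γ ∈ φ.present v ↔ ∃ e : H.edgeSet, v ∈ (e : Sym2 V) ∧ φ e = γ := by
  simp [EdgeColoring.present]

theorem mem_missing_iff (φ : H.EdgeColoring k) :
    γ ∈ φ.missing v ↔ ∀ e : H.edgeSet, v ∈ (e : Sym2 V) → φ e ≠ γ := by
  rw [EdgeColoring.missing, Finset.mem_sdiff, mem_present_iff]
  simp only [Finset.mem_univ, true_and, not_exists, not_and]

theorem coe_missing_eq (φ : H.EdgeColoring k) (hφ : ∀ e : H.edgeSet, c e = φ e) :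
    (φ.missing v : Set (Fin k)) = missing H c v := by
  ext γ
  rw [Finset.mem_coe, mem_missing_iff]
  constructor
  · exact fun h w hw => hφ ⟨s(v, w), hw⟩ ▸ h ⟨s(v, w), hw⟩ (Sym2.mem_mk_left v w)
  · rintro h ⟨e, he⟩ hv
    obtain ⟨w, rfl⟩ := Sym2.mem_iff_exists.1 hv
    exact hφ ⟨s(v, w), he⟩ ▸ h w he

theorem eq_of_color_eq (φ : H.EdgeColoring k) {e e' : H.edgeSet} (he : v ∈ (e : Sym2 V))
    (he' : v ∈ (e' : Sym2 V)) (h : φ e = φ e') : e = e' := by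
  by_contra hne
  exact φ.valid (lineGraph_adj_iff_exists.2 ⟨hne, v, he, he'⟩) h

theorem isProperOn_of_eq (φ : H.EdgeColoring k) (hφ : ∀ e : H.edgeSet, c e = φ e) :
    IsProperOn H c := by
  intro v w w' hw hw' h
  have h' : φ ⟨s(v, w), hw⟩ = φ ⟨s(v, w'), hw'⟩ := by rwa [← hφ, ← hφ]
  exact Sym2.congr_right.1 <|
    congrArg Subtype.val (eq_of_color_eq φ (Sym2.mem_mk_left v w) (Sym2.mem_mk_left v w') h')

theorem EdgeColorable.nonempty_edgeColoring (h : EdgeColorable G (Fin k)) :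
    Nonempty (G.EdgeColoring k) := by
  obtain ⟨c, hc⟩ := h
  refine ⟨Coloring.mk (fun e => c e) ?_⟩
  rintro ⟨e, he⟩ ⟨e', he'⟩ hadj heq
  obtain ⟨hne, v, hv, hv'⟩ := lineGraph_adj_iff_exists.1 hadj
  obtain ⟨w, rfl⟩ := Sym2.mem_iff_exists.1 hv
  obtain ⟨w', rfl⟩ := Sym2.mem_iff_exists.1 hv'
  obtain rfl : w = w' := hc he he' heq
  exact hne rfl

theorem card_missing_add_degree (φ : H.EdgeColoring k) (v : V) [Fintype (H.neighborSet v)] :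
    (φ.missing v).card + H.degree v = k := by
  have hpresent : (φ.present v).card = H.degree v := by
    refine (Finset.card_bij (fun w hw => φ ⟨s(v, w), (H.mem_neighborFinset v w).1 hw⟩)
      ?_ ?_ ?_).symm
    · intro w hw
      exact (mem_present_iff φ).2 ⟨_, Sym2.mem_mk_left v w, rfl⟩
    · intro w hw w' hw' h
      exact Sym2.congr_right.1 <| congrArg Subtype.val
        (eq_of_color_eq φ (Sym2.mem_mk_left v w) (Sym2.mem_mk_left v w') h)
    · intro γ hγ
      obtain ⟨⟨e, he⟩, hv, rfl⟩ := (mem_present_iff φ).1 hγ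
      obtain ⟨w, rfl⟩ := Sym2.mem_iff_exists.1 hv
      exact ⟨w, (H.mem_neighborFinset v w).2 he, rfl⟩
  rw [← hpresent, EdgeColoring.missing, Finset.card_sdiff_add_card_eq_card (Finset.subset_univ _),
    Finset.card_univ, Fintype.card_fin]

theorem isEmpty_edgeColoring_of_isClassTwo [Fintype V] [DecidableRel G.Adj] (hG : G.IsClassTwo) :
    IsEmpty (G.EdgeColoring G.maxDegree) := by
  by_contra! hφ
  refine hG (le_antisymm (chromaticNumber_le_iff_colorable.2 hφ) ?_)
  refine le_chromaticNumber_iff_colorable.2 fun k ⟨φ⟩ => ?_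
  exact G.maxDegree_le_of_forall_degree_le k fun v => by grind [card_missing_add_degree φ v]

theorem missing_nonempty [Fintype V] [DecidableRel G.Adj] (hab : G.Adj a b)
    (φ : (G.deleteEdges {s(a, b)}).EdgeColoring G.maxDegree) : (φ.missing b).Nonempty := by
  classical
  have hlt : (G.deleteEdges {s(a, b)}).degree b < G.degree b := by
    refine Finset.card_lt_card (Finset.ssubset_iff_subset_ne.2 ⟨?_, fun h => ?_⟩)
    · intro w hw
      rw [mem_neighborFinset] at hw ⊢
      exact deleteEdges_le _ hw
    · simpa [hab.symm, Sym2.eq_swap] using (Finset.ext_iff.1 h a)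
  rw [← Finset.card_pos]
  grind [card_missing_add_degree φ b, G.degree_le_maxDegree b]

theorem notMem_missing (φ : H.EdgeColoring k) (e : H.edgeSet) (hv : v ∈ (e : Sym2 V)) :
    φ e ∉ φ.missing v :=
  fun h => (mem_missing_iff φ).1 h e hv rfl

section KiersteadPath

variable {φ : (G.deleteEdges {s(a, b)}).EdgeColoring k}

theorem nodup_of_isKiersteadPath (hK : G.IsKiersteadPath s(a, b) φ ![a, b, u, x]) :
    [a, b, u, x].Nodup := by
  simpa using List.nodup_ofFn.2 hK.injective

theorem isStem_of_isKiersteadPath (hG : IsEmpty (G.EdgeColoring k))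
    (hK : G.IsKiersteadPath s(a, b) φ ![a, b, u, x])
    (hc : ∀ e : (G.deleteEdges {s(a, b)}).edgeSet, c e = φ e) :
    IsStem G a b u ↑(φ.missing a) ↑(φ.missing b) (c s(b, u)) c := by
  have hd := nodup_of_isKiersteadPath hK
  simp only [List.nodup_cons, List.mem_cons, List.not_mem_nil, or_false, not_or] at hd
  obtain ⟨hbu, j, hj, hcolor⟩ := hK.color 1 (by decide)
  refine ⟨fun h => not_isEmpty_iff.2 h.nonempty_edgeColoring hG, hd.1.1, hd.1.2.1, hbu,
    isProperOn_of_eq φ hc, (coe_missing_eq φ hc).le, (coe_missing_eq φ hc).le, rfl, ?_⟩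
  rw [Finset.mem_coe, hc ⟨s(b, u), hbu⟩]
  fin_cases j
  · exact hcolor
  · exact absurd hcolor (notMem_missing φ _ (by simp))
  all_goals exact absurd hj (by decide)

theorem isLeg_of_isKiersteadPath (hK : G.IsKiersteadPath s(a, b) φ ![a, b, u, x])
    (hc : ∀ e : (G.deleteEdges {s(a, b)}).edgeSet, c e = φ e)
    (hγ : γ ∈ φ.missing x ∩ (φ.missing a ∪ φ.missing b)) :
    IsLeg G a b u ↑(φ.missing a) ↑(φ.missing b) c x (c s(u, x)) γ := by
  have hd := nodup_of_isKiersteadPath hK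
  simp only [List.nodup_cons, List.mem_cons, List.not_mem_nil, or_false, not_or] at hd
  obtain ⟨hux, j, hj, hcolor⟩ := hK.color 2 (by decide)
  rw [Finset.mem_inter, ← Finset.mem_coe, coe_missing_eq φ hc, ← Finset.mem_coe,
    Finset.coe_union] at hγ
  refine ⟨hd.1.2.2, hd.2.1.2, hux, rfl, ?_, hγ.1, hγ.2⟩
  rw [hc ⟨s(u, x), hux⟩]
  fin_cases j
  · exact .inl hcolor
  · exact .inr hcolor
  · exact absurd hcolor (notMem_missing φ _ (by simp))
  · exact absurd hj (by decide)

end KiersteadPath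
end EdgeColoring

end Kempe

theorem lemma3p1_general {V : Type*} (G : SimpleGraph V) {k : ℕ}
    (hG : IsEmpty (G.EdgeColoring k)) (a b u x y : V) (hxy : x ≠ y)
    (φ : (G.deleteEdges {s(a, b)}).EdgeColoring k) (hb : (φ.missing b).Nonempty)
    (hK : G.IsKiersteadPath s(a, b) φ ![a, b, u, x])
    (hK' : G.IsKiersteadPath s(a, b) φ ![a, b, u, y]) :
    (φ.missing x ∩ (φ.missing a ∪ φ.missing b)).card +
      (φ.missing y ∩ (φ.missing a ∪ φ.missing b)).card ≤ 1 := by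
  obtain ⟨c, hc⟩ : ∃ c : Sym2 V → Fin k, ∀ e : (G.deleteEdges {s(a, b)}).edgeSet, c e = φ e :=
    ⟨Function.extend Subtype.val φ fun _ => hb.choose, Subtype.val_injective.extend_apply φ _⟩
  have hstem := Kempe.isStem_of_isKiersteadPath hG hK hc
  have hx {γ} := Kempe.isLeg_of_isKiersteadPath (γ := γ) hK hc
  have hy {γ} := Kempe.isLeg_of_isKiersteadPath (γ := γ) hK' hc
  have unique {v w p q γ δ} := hstem.leg_unique (x := v) (y := w) (p := p) (q := q) (δ := γ)
    (ε := δ) hb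
  rw [← Finset.card_disjSum, Finset.card_le_one]
  rintro (γ | γ) hγ (δ | δ) hδ <;>
    simp only [Finset.inl_mem_disjSum, Finset.inr_mem_disjSum] at hγ hδ
  · rw [(unique (hx hγ) (hx hδ)).2]
  · exact absurd (unique (hx hγ) (hy hδ)).1 hxy
  · exact absurd (unique (hx hδ) (hy hγ)).1 hxy
  · rw [(unique (hy hγ) (hy hδ)).2]

theorem lemma3p1 {V : Type*} [Fintype V] (G : SimpleGraph V) [DecidableRel G.Adj]
    (hG : G.IsClassTwo) (a b u x y : V) (hxy : x ≠ y)
    (φ : (G.deleteEdges {s(a, b)}).EdgeColoring G.maxDegree)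
    (hK : G.IsKiersteadPath s(a, b) φ ![a, b, u, x])
    (hK' : G.IsKiersteadPath s(a, b) φ ![a, b, u, y]) :
    (φ.missing x ∩ (φ.missing a ∪ φ.missing b)).card +
      (φ.missing y ∩ (φ.missing a ∪ φ.missing b)).card ≤ 1 :=
  lemma3p1_general G (Kempe.isEmpty_edgeColoring_of_isClassTwo hG) a b u x y hxy φ
    (Kempe.missing_nonempty (hK.adj 0) φ) hK hK'
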